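/- A sequence of prefix-rotations $\sigma_{r_1},\sigma_{r_2},\dots$ is written $r_1,r_2,\dots$. For a sequence $S=r_1,r_2,\dots$ define - $\mathrm{reuse}_n(S)$: replace every symbol $r$ of $S$ by $n,\dots,n,\;n+1-r$, with $n-1$ copies of $n$; - $\mathrm{recycle}_n(S)$: replace every symbol $r$ of $S$ by $n,n,\;n-1,\dots,n-1,\;n,\dots,n$, with $r-1$ copies of $n-1$ followed by $n-r-1$ copies of $n$; - $\mathrm{shift}^2(r_1,\dots,r_k)=r_3,\dots,r_k,r_1,r_2$; - for $S=T,n-1,n-1$ and $m\ge 2$, $\mathrm{rewind}_{n,m}(S)$: the sequence $T,n-1,n$, followed by $m-2$ copies of $T,n$, followed by $T,n-1,n$, followed by $m-2$ copies of $n$. Let $C_1=1$ and $C_k=\mathrm{recycle}_k(C_{k-1})$ for $k\ge 2$. Then each of the following three families of sequences can be generated by a loopless algorithm: 1. $\mathrm{reuse}_n(C_{n-1})$, for $n\ge 2$ (input $n$); 2. $\mathrm{rewind}_{n,m}(\mathrm{shift}^2(C_{n-1}))$, for $n\ge 3$ and $m\in\{2,\dots,n\}$ (input $n,m$); 3. $\mathrm{rewind}_{n,m}(\mathrm{shift}^2(\mathrm{reuse}_{n-1}(C_{n-2})))$,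 for $n\ge 3$ and $m\in\{2,\dots,n\}$ (input $n,m$). That is, for each family there are one program for a unit-cost word RAM and one constant $c$, both independent of $n$ and $m$, such that on every admissible input the program terminates and visits (outputs) exactly the symbols of the sequence in order. All numbers it stores, all array indices it writes to and all symbols it visits are at most $cn$; the first symbol is visited within time $cn$ (initialization); after that the time between two successive visits, and between the last visit and termination, is at most $c$ in the worst case. -/

import Mathlib

namespace Rotator

/-! ### The sequences

A sequence of rotations `σ_{r₁}, σ_{r₂}, …` is represented by the list `[r₁, r₂, …]`. -/

/-- Reusing: every `r` is replaced by `n, …, n, n+1-r`, with `n - 1` copies of `n`. -/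
def reuse (n : ℕ) (S : List ℕ) : List ℕ :=
  S.flatMap fun r => List.replicate (n - 1) n ++ [n + 1 - r]

/-- Recycling: every `r` is replaced by `n, n, n-1, …, n-1, n, …, n`, with `r - 1` copies
of `n - 1` and then `n - r - 1` copies of `n`. -/
def recycle (n : ℕ) (S : List ℕ) : List ℕ :=
  S.flatMap fun r => [n, n] ++ List.replicate (r - 1) (n - 1) ++ List.replicate (n - r - 1) n

/-- The canonical recycle sequences: the first is `1`, and the `k`-th is obtained by recycling
the `(k-1)`-st, whose largest symbol is `k - 1`. (The value at `0` is never used.) -/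
def recycleSeq : ℕ → List ℕ
  | 0 => []
  | 1 => [1]
  | k + 2 => recycle (k + 2) (recycleSeq (k + 1))

/-- Rewinding, for `S = T, n-1, n-1` and `m ≥ 2`: the sequence
`T, n-1, n`, then `m - 2` copies of `T, n`, then `T, n-1, n`, then `m - 2` copies of `n`. -/
def rewind (n m : ℕ) (S : List ℕ) : List ℕ :=
  let T := S.dropLast.dropLast
  T ++ [n - 1, n] ++ (List.replicate (m - 2) (T ++ [n])).flatten ++ T ++ [n - 1, n] ++
    List.replicate (m - 2) n

/-- `r₁, …, r_k` shifted twice: `r₃, …, r_k, r₁, r₂`. -/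
def shiftTwo (S : List ℕ) : List ℕ := S.rotate 2

/-! ### The machine model

A word RAM with structured control. A program handles finitely many scalar variables and
finitely many arrays (those named in its text), all holding natural numbers. An elementary
operation (constant, variable access, array access, addition, truncated subtraction,
remainder, comparison, assignment, call of the output routine) takes one unit of time. -/

/-- Expressions. -/
inductive Expr where
  | const (c : ℕ)
  | var (x : ℕ)
  | get (a : ℕ) (i : Expr)
  | add (e₁ e₂ : Expr)
  | sub (e₁ e₂ : Expr)
  | mod (e₁ e₂ : Expr)

/-- Commands. The guards of `ite` and `loop` are comparisons `e₁ ≤ e₂`. -/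
inductive Cmd where
  | skip
  | assign (x : ℕ) (e : Expr)
  | put (a : ℕ) (i e : Expr)
  | visit (e : Expr)
  | seq (p q : Cmd)
  | ite (e₁ e₂ : Expr) (p q : Cmd)
  | loop (e₁ e₂ : Expr) (p : Cmd)

/-- A memory state: the values of the scalar variables and the contents of the arrays. -/
structure Store where
  var : ℕ → ℕ
  arr : ℕ → ℕ → ℕ

/-- The initial state: the inputs are in the first variables, everything else is `0`. -/
def Store.input (args : List ℕ) : Store where
  var x := args.getD x 0
  arr _ _ := 0

/-- The state after the assignment of `v` to the variable `x`. -/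
def Store.setVar (s : Store) (x v : ℕ) : Store :=
  { s with var := Function.update s.var x v }

/-- The state after the assignment of `v` to the `i`-th cell of the array `a`. -/
def Store.setArr (s : Store) (a i v : ℕ) : Store :=
  { s with arr := Function.update s.arr a (Function.update (s.arr a) i v) }

/-- The value of an expression. -/
def Expr.eval (s : Store) : Expr → ℕ
  | .const c => c
  | .var x => s.var x
  | .get a i => s.arr a (i.eval s)
  | .add e₁ e₂ => e₁.eval s + e₂.eval s
  | .sub e₁ e₂ => e₁.eval s - e₂.eval s
  | .mod e₁ e₂ => e₁.eval s % e₂.eval s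

/-- The time needed to evaluate an expression: the number of its operations. -/
def Expr.cost : Expr → ℕ
  | .const _ => 1
  | .var _ => 1
  | .get _ i => i.cost + 1
  | .add e₁ e₂ => e₁.cost + e₂.cost + 1
  | .sub e₁ e₂ => e₁.cost + e₂.cost + 1
  | .mod e₁ e₂ => e₁.cost + e₂.cost + 1

/-- What an observer sees of a run: units of time that pass, and visited symbols. -/
inductive Event where
  | tick
  | visit (r : ℕ)

/-- `k` units of time. -/
def ticks (k : ℕ) : List Event := List.replicate k Event.tick

/-- `Exec W p s tr s'`: the program `p`, started in the state `s`, terminates in the state `s'`,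
and `tr` is the list of events of the run in chronological order. A machine word holds the
numbers `0, …, W`: a run that would store or visit a number above `W`, or write to an array
cell with an index above `W`, gets stuck. -/
inductive Exec (W : ℕ) : Cmd → Store → List Event → Store → Prop
  | skip (s : Store) : Exec W .skip s (ticks 1) s
  | assign (s : Store) (x : ℕ) (e : Expr) (he : e.eval s ≤ W) :
      Exec W (.assign x e) s (ticks (e.cost + 1)) (s.setVar x (e.eval s))
  | put (s : Store) (a : ℕ) (i e : Expr) (hi : i.eval s ≤ W) (he : e.eval s ≤ W) :
      Exec W (.put a i e) s (ticks (i.cost + e.cost + 1)) (s.setArr a (i.eval s) (e.eval s))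
  | visit (s : Store) (e : Expr) (he : e.eval s ≤ W) :
      Exec W (.visit e) s (ticks (e.cost + 1) ++ [Event.visit (e.eval s)]) s
  | seq (p q : Cmd) (s s' s'' : Store) (tr tr' : List Event)
      (hp : Exec W p s tr s') (hq : Exec W q s' tr' s'') :
      Exec W (.seq p q) s (tr ++ tr') s''
  | ite_true (e₁ e₂ : Expr) (p q : Cmd) (s s' : Store) (tr : List Event)
      (h : e₁.eval s ≤ e₂.eval s) (hp : Exec W p s tr s') :
      Exec W (.ite e₁ e₂ p q) s (ticks (e₁.cost + e₂.cost + 1) ++ tr) s'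
  | ite_false (e₁ e₂ : Expr) (p q : Cmd) (s s' : Store) (tr : List Event)
      (h : ¬ e₁.eval s ≤ e₂.eval s) (hq : Exec W q s tr s') :
      Exec W (.ite e₁ e₂ p q) s (ticks (e₁.cost + e₂.cost + 1) ++ tr) s'
  | loop_true (e₁ e₂ : Expr) (p : Cmd) (s s' s'' : Store) (tr tr' : List Event)
      (h : e₁.eval s ≤ e₂.eval s) (hp : Exec W p s tr s')
      (hl : Exec W (.loop e₁ e₂ p) s' tr' s'') :
      Exec W (.loop e₁ e₂ p) s (ticks (e₁.cost + e₂.cost + 1) ++ (tr ++ tr')) s''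
  | loop_false (e₁ e₂ : Expr) (p : Cmd) (s : Store)
      (h : ¬ e₁.eval s ≤ e₂.eval s) :
      Exec W (.loop e₁ e₂ p) s (ticks (e₁.cost + e₂.cost + 1)) s

/-- The symbols visited in a run, in order. -/
def visits (tr : List Event) : List ℕ :=
  tr.filterMap fun
    | Event.tick => none
    | Event.visit r => some r

/-- The time before the first visit is at most `c`. -/
def InitTimeLE (c : ℕ) (tr : List Event) : Prop :=
  ∀ (k : ℕ) (v : List Event), tr = ticks k ++ v → k ≤ c

/-- From the first visit on, never more than `c` units of time pass without a visit: neither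
between two successive visits nor between the last visit and termination. -/
def DelayLE (c : ℕ) (tr : List Event) : Prop :=
  ∀ (u v : List Event) (k : ℕ), tr = u ++ ticks k ++ v → visits u ≠ [] → k ≤ c

/-- On the input `args`, and with machine words that hold the numbers up to `C * n`, the program
`p` terminates and visits the successive symbols of `S`; it reaches the first visit within time
`C * n`, and from then on every delay is at most `C`. -/
def LooplesslyGenerates (p : Cmd) (C n : ℕ) (args : List ℕ) (S : List ℕ) : Prop :=
  ∃ (tr : List Event) (s : Store), Exec (C * n) p (Store.input args) tr s ∧
    visits tr = S ∧ InitTimeLE (C * n) tr ∧ DelayLE C tr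

end Rotator

namespace Rotator

/-! ### The recycle sequences as the readings of a counter

The position in `recycleSeq k` is kept in mixed radix: the digit `D j < j` is the position inside
the current block at level `j`, and `F j` is the current symbol at level `j`. -/

/-! Every symbol `r` of a recycled or reused sequence expands to a block of length `n` whose entry
at position `d` is an explicit function of `n`, `d`, `r` (`recycle_block`, `reuse_block`). Hence a
position in `recycleSeq k` is a mixed-radix number with digits `D j < j`, together with the symbols
`F j` they determine level by level. Each of the sequences to be generated is one further expansion
of some `recycleSeq k`, with blocks of length `k + 1`, up to rewinding.

An increment of the counter may have to carry through all `k` levels, which is not constant time.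
But a whole block of `k + 1` symbols is visited for each increment, so it suffices to treat one
level per visit. Two facts make this work. A block starts with `n` whatever symbol it replaces, so a
level that is reset can be written before the levels below it are known, and one descending sweep
suffices. And `carry`, applied to the unfinished state, is invariant under treating one level
(`wp_advance`), so the end result is that of the instantaneous increment, which `carry_spec`
identifies with moving to the next symbol.

An overflow leaves the counter at its start. A pass can therefore be repeated at once, and this
gives the copies of `T` in a rewound sequence; after `shiftTwo`, `T` is the unshifted sequence
without its first two symbols. Time is tracked by the gap since the last visit, in a
weakest-precondition calculus (`WP`). -/

/-- The symbol at position `d` of the block of length `n` by which recycling replaces `r`. -/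
def recycleSym (n d r : ℕ) : ℕ := if d ≤ 1 then n else if d ≤ r then n - 1 else n

theorem recycleSym_le (n d r : ℕ) : recycleSym n d r ≤ n := by
  unfold recycleSym
  split_ifs <;> omega

/-- The symbol at position `d` of the block of length `n` by which reusing replaces `r`. -/
def reuseSym (n d r : ℕ) : ℕ := if d + 2 ≤ n then n else n + 1 - r

/-- The block of length `n` that replaces `r`, for the symbols given by `f`. -/
def block (f : ℕ → ℕ → ℕ → ℕ) (n r : ℕ) : List ℕ := (List.range n).map fun d => f n d r

theorem length_block (f : ℕ → ℕ → ℕ → ℕ) (n r : ℕ) : (block f n r).length = n := by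
  simp [block]

theorem drop_block (f : ℕ → ℕ → ℕ → ℕ) {n d : ℕ} (r : ℕ) (h : d < n) :
    (block f n r).drop d = f n d r :: (block f n r).drop (d + 1) := by
  rw [List.drop_eq_getElem_cons (by simpa [length_block] using h)]
  simp [block]

/-- The bounds on `r` rule out truncation in `r - 1` and `n - r - 1`, so the block has length
exactly `n`. `mem_recycleSeq` supplies them. -/
theorem recycle_block {n r : ℕ} (h₁ : 1 ≤ r) (h₂ : r < n) :
    [n, n] ++ List.replicate (r - 1) (n - 1) ++ List.replicate (n - r - 1) n =
      block recycleSym n r := by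
  apply List.ext_getElem
  · simp [block]; omega
  · intro i hi _
    simp only [block, List.getElem_map, List.getElem_range, recycleSym]
    rcases i with _ | _ | i
    · simp
    · simp
    · simp [List.getElem_append]
      split_ifs <;> first | rfl | omega

theorem reuse_block {n : ℕ} (r : ℕ) (h : 1 ≤ n) :
    List.replicate (n - 1) n ++ [n + 1 - r] = block reuseSym n r := by
  apply List.ext_getElem
  · simp [block]; omega
  · intro i hi _
    simp only [block, List.getElem_map, List.getElem_range, reuseSym]
    simp [List.getElem_append]
    split_ifs <;> first | rfl | omega

theorem mem_recycleSeq {k : ℕ} : ∀ {r : ℕ}, r ∈ recycleSeq k → 1 ≤ r ∧ r ≤ k := by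
  induction k using recycleSeq.induct with
  | case1 => simp [recycleSeq]
  | case2 => simp [recycleSeq]
  | case3 k ih =>
    intro r hr
    simp only [recycleSeq, recycle, List.mem_flatMap] at hr
    obtain ⟨q, hq, hr⟩ := hr
    obtain ⟨h₁, h₂⟩ := ih hq
    simp at hr
    omega

theorem flatMap_congr_mem {l : List ℕ} {f g : ℕ → List ℕ} (h : ∀ r ∈ l, f r = g r) :
    l.flatMap f = l.flatMap g := by
  induction l with
  | nil => rfl
  | cons a l ih =>
    simp only [List.flatMap_cons]
    rw [h a (by simp), ih fun r hr => h r (by simp [hr])]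

theorem recycleSeq_succ {k : ℕ} (hk : 1 ≤ k) :
    recycleSeq (k + 1) = (recycleSeq k).flatMap (block recycleSym (k + 1)) := by
  obtain ⟨k, rfl⟩ : ∃ l, k = l + 1 := ⟨k - 1, by omega⟩
  rw [recycleSeq, recycle]
  apply flatMap_congr_mem
  intro r hr
  have := mem_recycleSeq hr
  exact recycle_block this.1 (by omega)

theorem reuse_eq {n : ℕ} (S : List ℕ) (hn : 1 ≤ n) : reuse n S = S.flatMap (block reuseSym n) :=
  flatMap_congr_mem fun r _ => reuse_block r hn

theorem recycleSeq_ne_nil {k : ℕ} (hk : 1 ≤ k) : recycleSeq k ≠ [] := by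
  induction k, hk using Nat.le_induction with
  | base => simp [recycleSeq]
  | succ k hk ih =>
    rw [recycleSeq_succ hk]
    obtain ⟨x, l, h⟩ := List.exists_cons_of_ne_nil ih
    rw [h, List.flatMap_cons]
    intro h
    have := congrArg List.length h
    simp [length_block] at this

/-! ### Incrementing the counter -/

/-- Advances the counter by one, where the levels above `i` have already been reset. The last
component becomes `0` unless the counter overflows. -/
def carry : ℕ → (ℕ → ℕ) → (ℕ → ℕ) → ℕ → (ℕ → ℕ) × (ℕ → ℕ) × ℕ
  | 0, D, F, o => (D, F, o)
  | i + 1, D, F, o =>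
    if D (i + 1) + 2 ≤ i + 1 then
      (Function.update D (i + 1) (D (i + 1) + 1),
        Function.update F (i + 1) (recycleSym (i + 1) (D (i + 1) + 1) (F i)), 0)
    else carry i (Function.update D (i + 1) 0) (Function.update F (i + 1) (i + 1)) o

/-- The digits are in range, and the symbols are the ones at the positions they describe. -/
def Valid (k : ℕ) (D F : ℕ → ℕ) : Prop :=
  ∀ j, 1 ≤ j → j ≤ k → D j < j ∧ F j = recycleSym j (D j) (F (j - 1))

/-- The counter is at the first position. -/
def AtStart (k : ℕ) (D F : ℕ → ℕ) : Prop := ∀ j, 1 ≤ j → j ≤ k → D j = 0 ∧ F j = j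

/-- The part of `recycleSeq k` from the current position on. -/
def remaining : ℕ → (ℕ → ℕ) → (ℕ → ℕ) → List ℕ
  | 0, _, _ => []
  | 1, _, _ => [1]
  | k + 2, D, F => (block recycleSym (k + 2) (F (k + 1))).drop (D (k + 2)) ++
      (remaining (k + 1) D F).tail.flatMap (block recycleSym (k + 2))

theorem AtStart.valid {k : ℕ} {D F : ℕ → ℕ} (h : AtStart k D F) : Valid k D F := by
  intro j h₁ h₂
  obtain ⟨hD, hF⟩ := h j h₁ h₂
  rw [hD, hF]
  exact ⟨h₁, by simp [recycleSym]⟩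

theorem remaining_congr {k : ℕ} {D F D' F' : ℕ → ℕ} (hD : ∀ j ≤ k, D j = D' j)
    (hF : ∀ j ≤ k, F j = F' j) : remaining k D F = remaining k D' F' := by
  induction k using recycleSeq.induct with
  | case1 => rfl
  | case2 => rfl
  | case3 k ih =>
    rw [remaining, remaining, ih (fun j hj => hD j (by omega)) (fun j hj => hF j (by omega)),
      hD _ le_rfl, hF (k + 1) (by omega)]

theorem Valid.remaining_eq {k : ℕ} {D F : ℕ → ℕ} (h : Valid k D F) (hk : 1 ≤ k) :
    remaining k D F = F k :: (remaining k D F).tail := by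
  obtain ⟨hD, hF⟩ := h k hk le_rfl
  match k, hk with
  | 1, _ =>
    have : D 1 = 0 := by omega
    rw [this] at hF
    simp [remaining, hF, recycleSym]
  | k + 2, _ =>
    rw [hF]
    simp only [remaining, drop_block _ _ hD]
    simp

theorem AtStart.remaining_eq {k : ℕ} {D F : ℕ → ℕ} (h : AtStart k D F) :
    remaining k D F = recycleSeq k := by
  induction k using recycleSeq.induct with
  | case1 => rfl
  | case2 => rfl
  | case3 k ih =>
    have h' : AtStart (k + 1) D F := fun j h₁ h₂ => h j h₁ (by omega)
    rw [recycleSeq_succ (by omega), remaining, (h (k + 2) (by omega) le_rfl).1, ← ih h']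
    conv_rhs => rw [h'.valid.remaining_eq (by omega)]
    simp

theorem carry_above {i j : ℕ} (hij : i < j) (D F : ℕ → ℕ) (o : ℕ) :
    (carry i D F o).1 j = D j ∧ (carry i D F o).2.1 j = F j := by
  induction i generalizing D F with
  | zero => simp [carry]
  | succ i ih =>
    rw [carry]
    split_ifs
    · simp [Function.update_of_ne (show j ≠ i + 1 by omega)]
    · obtain ⟨h₁, h₂⟩ := ih (by omega) (Function.update D (i + 1) 0)
        (Function.update F (i + 1) (i + 1))
      simp [h₁, h₂, Function.update_of_ne (show j ≠ i + 1 by omega)]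

theorem carry_valid {k : ℕ} {D F : ℕ → ℕ} (h : Valid k D F) (o : ℕ) :
    Valid k (carry k D F o).1 (carry k D F o).2.1 := by
  induction k generalizing D F with
  | zero => intro j h₁ h₂; omega
  | succ k ih =>
    rw [carry]
    split_ifs with hd
    · intro j h₁ h₂
      rcases eq_or_ne j (k + 1) with rfl | hj
      · simp; omega
      · have := h j h₁ h₂
        simpa [Function.update_of_ne hj, Function.update_of_ne (show j - 1 ≠ k + 1 by omega)]
    · have hv : Valid k (Function.update D (k + 1) 0) (Function.update F (k + 1) (k + 1)) := by
        intro j h₁ h₂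
        have := h j h₁ (by omega)
        simpa [Function.update_of_ne (show j ≠ k + 1 by omega),
          Function.update_of_ne (show j - 1 ≠ k + 1 by omega)]
      intro j h₁ h₂
      rcases eq_or_ne j (k + 1) with rfl | hj
      · obtain ⟨e₁, e₂⟩ := carry_above (show k < k + 1 by omega) (Function.update D (k + 1) 0)
          (Function.update F (k + 1) (k + 1)) o
        rw [e₁, e₂]
        -- The carry below may have changed the symbol at level `k`, but at digit `0` the symbol
        -- does not depend on it.
        simp [recycleSym]
      · exact ih hv j h₁ (by omega)

/-- Advancing the counter removes the current symbol from the remaining part; after the last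
symbol the counter is back at its start. -/
theorem carry_spec {k : ℕ} {D F : ℕ → ℕ} (hk : 1 ≤ k) (h : Valid k D F) :
    ((remaining k D F).tail = [] → (carry k D F 1).2.2 = 1 ∧
      AtStart k (carry k D F 1).1 (carry k D F 1).2.1) ∧
    ((remaining k D F).tail ≠ [] → (carry k D F 1).2.2 = 0 ∧
      remaining k (carry k D F 1).1 (carry k D F 1).2.1 = (remaining k D F).tail) := by
  induction k, hk using Nat.le_induction generalizing D F with
  | base =>
    have := (h 1 le_rfl le_rfl).1
    have hc : carry 1 D F 1 = (Function.update D 1 0, Function.update F 1 1, 1) := by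
      simp [carry]
    rw [hc]
    simp only [remaining, List.tail_cons]
    refine ⟨fun _ => ⟨trivial, ?_⟩, fun h => absurd rfl h⟩
    intro j h₁ h₂
    obtain rfl : j = 1 := by omega
    simp
  | succ k hk ih =>
    obtain ⟨l, rfl⟩ : ∃ l, k = l + 1 := ⟨k - 1, by omega⟩
    have hd := (h (l + 2) (by omega) le_rfl).1
    have htail : (remaining (l + 2) D F).tail =
        (block recycleSym (l + 2) (F (l + 1))).drop (D (l + 2) + 1) ++
          (remaining (l + 1) D F).tail.flatMap (block recycleSym (l + 2)) := by
      simp only [remaining]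
      rw [drop_block _ _ hd]
      simp
    rw [htail]
    by_cases hc : D (l + 2) + 2 ≤ l + 2
    · have hcar : carry (l + 2) D F 1 = (Function.update D (l + 2) (D (l + 2) + 1),
          Function.update F (l + 2) (recycleSym (l + 2) (D (l + 2) + 1) (F (l + 1))), 0) := by
        rw [carry, if_pos hc]
      rw [hcar, drop_block _ _ (show D (l + 2) + 1 < l + 2 by omega)]
      refine ⟨fun h => by simp at h, fun _ => ⟨rfl, ?_⟩⟩
      rw [remaining, remaining_congr (k := l + 1) (D' := D) (F' := F)
        (fun j hj => Function.update_of_ne (by omega) _ _)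
        (fun j hj => Function.update_of_ne (by omega) _ _)]
      simp [drop_block recycleSym (F (l + 1)) (show D (l + 2) + 1 < l + 2 by omega)]
    · have hD : D (l + 2) = l + 1 := by omega
      set D₁ := Function.update D (l + 2) 0
      set F₁ := Function.update F (l + 2) (l + 2)
      have hcar : carry (l + 2) D F 1 = carry (l + 1) D₁ F₁ 1 := by
        rw [carry, if_neg hc]
      have hv : Valid (l + 1) D₁ F₁ := by
        intro j h₁ h₂
        have := h j h₁ (by omega)
        simpa [D₁, F₁, Function.update_of_ne (show j ≠ l + 2 by omega),
          Function.update_of_ne (show j - 1 ≠ l + 2 by omega)]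
      have hrem : remaining (l + 1) D F = remaining (l + 1) D₁ F₁ :=
        remaining_congr (fun j hj => (Function.update_of_ne (by omega) _ _).symm)
          (fun j hj => (Function.update_of_ne (by omega) _ _).symm)
      have hdrop : (block recycleSym (l + 2) (F (l + 1))).drop (D (l + 2) + 1) = [] := by
        apply List.drop_of_length_le
        simp [length_block, hD]
      obtain ⟨a₁, a₂⟩ := carry_above (show l + 1 < l + 2 by omega) D₁ F₁ 1
      have b₁ : D₁ (l + 2) = 0 := by simp [D₁]
      have b₂ : F₁ (l + 2) = l + 2 := by simp [F₁]
      obtain ⟨ih₁, ih₂⟩ := ih hv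
      rw [hcar, hdrop, List.nil_append, hrem]
      constructor
      · intro h0
        -- Blocks are nonempty, so an empty expansion comes from an empty list.
        have ht : (remaining (l + 1) D₁ F₁).tail = [] := by
          by_contra hne
          obtain ⟨x, t, hx⟩ := List.exists_cons_of_ne_nil hne
          rw [hx, List.flatMap_cons] at h0
          have := congrArg List.length h0
          simp [length_block] at this
        obtain ⟨h₁, h₂⟩ := ih₁ ht
        refine ⟨h₁, fun j hj hj' => ?_⟩
        rcases eq_or_ne j (l + 2) with rfl | hne
        · rw [a₁, a₂]; exact ⟨b₁, b₂⟩
        · exact h₂ j hj (by omega)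
      · intro h0
        have ht : (remaining (l + 1) D₁ F₁).tail ≠ [] := by
          intro hne
          rw [hne] at h0
          exact h0 rfl
        obtain ⟨h₁, h₂⟩ := ih₂ ht
        refine ⟨h₁, ?_⟩
        -- The top digit is now `0`: the full block of the new symbol lies ahead, and it is the head
        -- of the expanded tail.
        have hv' := (carry_valid hv 1).remaining_eq (by omega)
        rw [remaining, a₁, b₁, List.drop_zero, ← h₂]
        conv_rhs => rw [hv', List.flatMap_cons]

/-- The two symbols that `rewind` cuts off at the end are those that `shiftTwo` moved there from the
front; their values play no role. -/
theorem rewind_shiftTwo (n m : ℕ) {S : List ℕ} (hS : 2 ≤ S.length) :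
    rewind n m (shiftTwo S) =
      S.drop 2 ++ [n - 1, n] ++ (List.replicate (m - 2) (S.drop 2 ++ [n])).flatten ++
        S.drop 2 ++ [n - 1, n] ++ List.replicate (m - 2) n := by
  have : (shiftTwo S).dropLast.dropLast = S.drop 2 := by
    match S, hS with
    | a :: b :: l, _ => simp [shiftTwo, List.dropLast_append_of_ne_nil]
  simp only [rewind, this]

/-! ### A calculus for timed runs -/

/-- If `g` units of time have passed since the last visit before the run `tr`, then during `tr`
this number never rises above `P`, and it is `g'` at the end. -/
def Paced (P : ℕ) : ℕ → List Event → ℕ → Prop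
  | g, [], g' => g = g'
  | g, .tick :: tr, g' => g + 1 ≤ P ∧ Paced P (g + 1) tr g'
  | _, .visit _ :: tr, g' => Paced P 0 tr g'

theorem Paced.append {P : ℕ} {tr tr' : List Event} : ∀ {g g' g'' : ℕ}, Paced P g tr g' →
    Paced P g' tr' g'' → Paced P g (tr ++ tr') g'' := by
  induction tr with
  | nil => intro g g' g'' h h'; cases h; exact h'
  | cons e tr ih =>
    intro g g' g'' h h'
    cases e with
    | tick => exact ⟨h.1, ih h.2 h'⟩
    | visit r => exact ih (g := 0) h h'

theorem Paced.of_append {P : ℕ} {tr tr' : List Event} : ∀ {g g'' : ℕ},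
    Paced P g (tr ++ tr') g'' → ∃ g', Paced P g tr g' ∧ Paced P g' tr' g'' := by
  induction tr with
  | nil => intro g g'' h; exact ⟨g, rfl, h⟩
  | cons e tr ih =>
    intro g g'' h
    cases e with
    | tick =>
      obtain ⟨g', h₁, h₂⟩ := ih h.2
      exact ⟨g', ⟨h.1, h₁⟩, h₂⟩
    | visit r => exact ih (g := 0) h

theorem paced_ticks {P k : ℕ} : ∀ {g : ℕ}, g + k ≤ P → Paced P g (ticks k) (g + k) := by
  induction k with
  | zero => intro g _; rfl
  | succ k ih =>
    intro g h
    refine ⟨by omega, ?_⟩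
    have := ih (g := g + 1) (by omega)
    rwa [show g + (k + 1) = g + 1 + k by omega]

theorem Paced.le_of_ticks {P k : ℕ} : ∀ {g g' : ℕ}, Paced P g (ticks k) g' → g ≤ P →
    g' = g + k ∧ g + k ≤ P := by
  induction k with
  | zero => intro g g' h hg; cases h; exact ⟨rfl, hg⟩
  | succ k ih =>
    intro g g' h hg
    have := ih (g := g + 1) h.2 h.1
    omega

theorem Paced.le {P : ℕ} {tr : List Event} : ∀ {g g' : ℕ}, Paced P g tr g' → g ≤ P → g' ≤ P := by
  induction tr with
  | nil => intro g g' h hg; cases h; exact hg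
  | cons e tr ih =>
    intro g g' h hg
    cases e with
    | tick => exact ih h.2 h.1
    | visit r => exact ih (g := 0) h (Nat.zero_le P)

theorem visits_append (tr tr' : List Event) : visits (tr ++ tr') = visits tr ++ visits tr' :=
  List.filterMap_append

theorem visits_ticks (k : ℕ) : visits (ticks k) = [] := by
  simp [visits, ticks]

theorem eq_ticks_of_visits_eq_nil {tr : List Event} (h : visits tr = []) :
    tr = ticks tr.length := by
  induction tr with
  | nil => rfl
  | cons e tr ih =>
    cases e with
    | tick =>
      have := ih (by simpa [visits] using h)
      conv_lhs => rw [this]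
      rfl
    | visit r => simp [visits] at h

/-- A uniformly paced run has bounded delay, also after an initialization. -/
theorem Paced.delayLE {P : ℕ} {tr : List Event} {g' : ℕ} (h : Paced P 0 tr g') (k : ℕ) :
    DelayLE P (ticks k ++ tr) := by
  induction k with
  | zero =>
    intro u v j e _
    change tr = _ at e
    rw [e] at h
    obtain ⟨g₁, h₁, -⟩ := h.of_append
    obtain ⟨g₂, h₂, h₃⟩ := h₁.of_append
    have := h₃.le_of_ticks (h₂.le (Nat.zero_le P))
    omega
  | succ k ih =>
    intro u v j e hu
    change Event.tick :: (ticks k ++ tr) = _ at e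
    cases u with
    -- The prefix contains a visit, so it cannot end within the initial ticks; they are stripped one
    -- by one.
    | nil => exact absurd rfl hu
    | cons a u =>
      simp only [List.cons_append, List.cons.injEq] at e
      obtain ⟨rfl, e⟩ := e
      exact ih u v j (by simpa using e) (by simpa [visits] using hu)

theorem Paced.initTimeLE {P : ℕ} {tr : List Event} {g' : ℕ} (h : Paced P 0 tr g') (k : ℕ) :
    InitTimeLE (k + P) (ticks k ++ tr) := by
  intro j v e
  by_contra! hj
  obtain ⟨i, rfl⟩ : ∃ i, j = k + i := ⟨j - k, by omega⟩
  have e' : ticks (k + i) = ticks k ++ ticks i := List.replicate_add _ _ _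
  rw [e', List.append_assoc] at e
  have := List.append_cancel_left e
  rw [this] at h
  obtain ⟨g₁, h₁, -⟩ := h.of_append
  have := h₁.le_of_ticks (Nat.zero_le P)
  omega

theorem DelayLE.mono {a b : ℕ} {tr : List Event} (h : DelayLE a tr) (hab : a ≤ b) :
    DelayLE b tr := fun u v k e hu => (h u v k e hu).trans hab

theorem InitTimeLE.mono {a b : ℕ} {tr : List Event} (h : InitTimeLE a tr) (hab : a ≤ b) :
    InitTimeLE b tr := fun k v e => (h k v e).trans hab

/-- Started in the state `s`, with `g` units of time since the last visit, the program `p`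
terminates, paced by `P`, and `Q` holds for the visited symbols, the final state, and the time
since the last visit. -/
def WP (W P : ℕ) (p : Cmd) (Q : List ℕ → Store → ℕ → Prop) (s : Store) (g : ℕ) : Prop :=
  ∃ tr s' g', Exec W p s tr s' ∧ Paced P g tr g' ∧ Q (visits tr) s' g'

section

variable {W P : ℕ} {Q : List ℕ → Store → ℕ → Prop} {s : Store} {g : ℕ}

theorem WP.skip (hg : g + 1 ≤ P) (h : Q [] s (g + 1)) : WP W P .skip Q s g :=
  ⟨_, _, _, .skip s, paced_ticks hg, by rwa [visits_ticks]⟩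

theorem WP.assign {x : ℕ} {e : Expr} (he : e.eval s ≤ W) (hg : g + (e.cost + 1) ≤ P)
    (h : Q [] (s.setVar x (e.eval s)) (g + (e.cost + 1))) : WP W P (.assign x e) Q s g :=
  ⟨_, _, _, .assign s x e he, paced_ticks hg, by rwa [visits_ticks]⟩

theorem WP.put {a : ℕ} {i e : Expr} (hi : i.eval s ≤ W) (he : e.eval s ≤ W)
    (hg : g + (i.cost + e.cost + 1) ≤ P)
    (h : Q [] (s.setArr a (i.eval s) (e.eval s)) (g + (i.cost + e.cost + 1))) :
    WP W P (.put a i e) Q s g :=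
  ⟨_, _, _, .put s a i e hi he, paced_ticks hg, by rwa [visits_ticks]⟩

theorem WP.visit {e : Expr} (he : e.eval s ≤ W) (hg : g + (e.cost + 1) ≤ P)
    (h : Q [e.eval s] s 0) : WP W P (.visit e) Q s g :=
  ⟨_, _, _, .visit s e he, (paced_ticks hg).append (g'' := 0) (rfl : 0 = 0), by
    rw [visits_append, visits_ticks]; exact h⟩

theorem WP.seq {p q : Cmd}
    (h : WP W P p (fun vs s' g' => WP W P q (fun vs' => Q (vs ++ vs')) s' g') s g) :
    WP W P (.seq p q) Q s g := by
  obtain ⟨tr, s', g', h₁, h₂, tr', s'', g'', h₃, h₄, h₅⟩ := h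
  exact ⟨_, _, _, .seq p q s s' s'' tr tr' h₁ h₃, h₂.append h₄, by rwa [visits_append]⟩

theorem WP.ite {e₁ e₂ : Expr} {p q : Cmd} (hg : g + (e₁.cost + e₂.cost + 1) ≤ P)
    (hp : e₁.eval s ≤ e₂.eval s → WP W P p Q s (g + (e₁.cost + e₂.cost + 1)))
    (hq : ¬ e₁.eval s ≤ e₂.eval s → WP W P q Q s (g + (e₁.cost + e₂.cost + 1))) :
    WP W P (.ite e₁ e₂ p q) Q s g := by
  by_cases h : e₁.eval s ≤ e₂.eval s
  · obtain ⟨tr, s', g', h₁, h₂, h₃⟩ := hp h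
    exact ⟨_, _, _, .ite_true e₁ e₂ p q s s' tr h h₁, (paced_ticks hg).append h₂, by
      rwa [visits_append, visits_ticks]⟩
  · obtain ⟨tr, s', g', h₁, h₂, h₃⟩ := hq h
    exact ⟨_, _, _, .ite_false e₁ e₂ p q s s' tr h h₁, (paced_ticks hg).append h₂, by
      rwa [visits_append, visits_ticks]⟩

theorem WP.loop_true {e₁ e₂ : Expr} {p : Cmd} (hc : e₁.eval s ≤ e₂.eval s)
    (hg : g + (e₁.cost + e₂.cost + 1) ≤ P)
    (h : WP W P p (fun vs s' g' => WP W P (.loop e₁ e₂ p) (fun vs' => Q (vs ++ vs')) s' g') s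
      (g + (e₁.cost + e₂.cost + 1))) :
    WP W P (.loop e₁ e₂ p) Q s g := by
  obtain ⟨tr, s', g', h₁, h₂, tr', s'', g'', h₃, h₄, h₅⟩ := h
  exact ⟨_, _, _, .loop_true e₁ e₂ p s s' s'' tr tr' hc h₁ h₃,
    (paced_ticks hg).append (h₂.append h₄), by
      rwa [visits_append, visits_append, visits_ticks]⟩

theorem WP.loop_false {e₁ e₂ : Expr} {p : Cmd} (hc : ¬ e₁.eval s ≤ e₂.eval s)
    (hg : g + (e₁.cost + e₂.cost + 1) ≤ P) (h : Q [] s (g + (e₁.cost + e₂.cost + 1))) :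
    WP W P (.loop e₁ e₂ p) Q s g :=
  ⟨_, _, _, .loop_false e₁ e₂ p s hc, paced_ticks hg, by rwa [visits_ticks]⟩

end

/-- An initialization without visits, followed by a paced main part. -/
theorem LooplesslyGenerates.of_wp {p q : Cmd} {C P K n : ℕ} {args S : List ℕ}
    (h : WP (C * n) K p (fun vs s _ => vs = [] ∧ WP (C * n) P q (fun vs' _ _ => vs' = S) s 0)
      (Store.input args) 0) (hP : P ≤ C) (hK : K + P ≤ C * n) :
    LooplesslyGenerates (.seq p q) C n args S := by
  obtain ⟨tr, s', g', h₁, h₂, h₃, tr', s'', g'', h₄, h₅, h₆⟩ := h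
  have e := eq_ticks_of_visits_eq_nil h₃
  have hle : tr.length ≤ K := by
    rw [e] at h₂
    have := h₂.le_of_ticks (Nat.zero_le K)
    omega
  refine ⟨tr ++ tr', s'', .seq p q _ s' s'' tr tr' h₁ h₄, ?_, ?_, ?_⟩
  · rw [visits_append, h₃, h₆]; rfl
  · rw [e]; exact (h₅.initTimeLE _).mono (by omega)
  · rw [e]; exact (h₅.delayLE _).mono hP

/-! ### The programs

The variables `0` and `1` hold the inputs, `2` holds the block length `N`, `3` counts
repetitions, `5` is the level at which a carry is pending (`0` if none), `6` is the position in
the current block, `7` the symbol that the block replaces, and `8` is `1` after an overflow of the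
counter. The arrays `0` and `1` hold the digits and the symbols of the counter.

A carry through all the levels takes time proportional to `N`; it is spread over the visits of the
current block, one level at a time. -/

/-- Treats one level of the pending carry, if there is one. -/
def advance : Cmd :=
  .ite (.const 1) (.var 5)
    (.ite (.add (.get 0 (.var 5)) (.const 2)) (.var 5)
      (.seq (.put 0 (.var 5) (.add (.get 0 (.var 5)) (.const 1)))
      (.seq (.ite (.get 0 (.var 5)) (.const 1)
          (.put 1 (.var 5) (.var 5))
          (.ite (.get 0 (.var 5)) (.get 1 (.sub (.var 5) (.const 1)))
            (.put 1 (.var 5) (.sub (.var 5) (.const 1)))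
            (.put 1 (.var 5) (.var 5))))
      (.seq (.assign 8 (.const 0)) (.assign 5 (.const 0)))))
      (.seq (.put 0 (.var 5) (.const 0))
      (.seq (.put 1 (.var 5) (.var 5)) (.assign 5 (.sub (.var 5) (.const 1))))))
    .skip

/-- Visits the rest of the current block; `vis` visits a single symbol. -/
def blockLoop (vis : Cmd) : Cmd :=
  .loop (.add (.var 6) (.const 1)) (.var 2)
    (.seq vis (.seq (.assign 6 (.add (.var 6) (.const 1))) advance))

/-- Starts to advance the counter, and visits the rest of the current block. -/
def blockPass (vis : Cmd) : Cmd :=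
  .seq (.assign 7 (.get 1 (.sub (.var 2) (.const 1))))
  (.seq (.assign 5 (.sub (.var 2) (.const 1)))
  (.seq (.assign 8 (.const 1))
  (.seq advance
  (.seq (blockLoop vis) (.assign 6 (.const 0))))))

/-- Visits the remaining blocks, until the counter overflows. -/
def passLoop (vis : Cmd) : Cmd := .loop (.var 8) (.const 0) (blockPass vis)

/-- Visits all the blocks, without the first `d` symbols. -/
def pass (vis : Cmd) (d : ℕ) : Cmd :=
  .seq (.assign 8 (.const 0)) (.seq (.assign 6 (.const d)) (passLoop vis))

/-- Sets the block length and moves the counter to its start. -/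
def setup (e : Expr) : Cmd :=
  .seq (.assign 2 e)
  (.seq (.assign 3 (.const 1))
    (.loop (.add (.var 3) (.const 1)) (.var 2)
      (.seq (.put 1 (.var 3) (.var 3)) (.assign 3 (.add (.var 3) (.const 1))))))

/-- The main part of the program for a rewound sequence. -/
def rewindMain (vis : Cmd) : Cmd :=
  .seq (pass vis 2)
  (.seq (.visit (.sub (.var 0) (.const 1)))
  (.seq (.visit (.var 0))
  (.seq (.assign 3 (.const 2))
  (.seq (.loop (.add (.var 3) (.const 1)) (.var 1)
    (.seq (pass vis 2)
    (.seq (.visit (.var 0)) (.assign 3 (.add (.var 3) (.const 1))))))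
  (.seq (pass vis 2)
  (.seq (.visit (.sub (.var 0) (.const 1)))
  (.seq (.visit (.var 0))
  (.seq (.assign 3 (.const 2))
    (.loop (.add (.var 3) (.const 1)) (.var 1)
      (.seq (.visit (.var 0)) (.assign 3 (.add (.var 3) (.const 1)))))))))))))

/-- Visits the current symbol of a recycled sequence. -/
def visitRecycle : Cmd :=
  .ite (.var 6) (.const 1) (.visit (.var 2))
    (.ite (.var 6) (.var 7) (.visit (.sub (.var 2) (.const 1))) (.visit (.var 2)))

/-- Visits the current symbol of a reused sequence. -/
def visitReuse : Cmd :=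
  .ite (.add (.var 6) (.const 2)) (.var 2) (.visit (.var 2))
    (.visit (.sub (.add (.var 2) (.const 1)) (.var 7)))

/-- `vis` visits the symbol given by `f`, and does nothing else. -/
def Visits (vis : Cmd) (f : ℕ → ℕ → ℕ → ℕ) : Prop :=
  ∀ (W : ℕ) (Q : List ℕ → Store → ℕ → Prop) (s : Store) (g : ℕ), s.var 2 + 1 ≤ W → g ≤ 900 →
    Q [f (s.var 2) (s.var 6) (s.var 7)] s 0 → WP W 1000 vis Q s g

/-! ### Correctness and timing of the programs -/

theorem visits_visitRecycle : Visits visitRecycle recycleSym := by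
  intro W Q s g hW hg hQ
  apply WP.ite
  · simp [Expr.cost]; omega
  · intro h
    simp only [Expr.eval] at h
    apply WP.visit <;> simp only [Expr.eval, Expr.cost] <;> try omega
    simpa [recycleSym, h] using hQ
  · intro h
    simp only [Expr.eval] at h
    apply WP.ite
    · simp [Expr.cost]; omega
    · intro h'
      simp only [Expr.eval] at h'
      apply WP.visit <;> simp only [Expr.eval, Expr.cost] <;> try omega
      simpa [recycleSym, h, h'] using hQ
    · intro h'
      simp only [Expr.eval] at h'
      apply WP.visit <;> simp only [Expr.eval, Expr.cost] <;> try omega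
      simpa [recycleSym, h, h'] using hQ

theorem visits_visitReuse : Visits visitReuse reuseSym := by
  intro W Q s g hW hg hQ
  apply WP.ite
  · simp [Expr.cost]; omega
  · intro h
    simp only [Expr.eval] at h
    apply WP.visit <;> simp only [Expr.eval, Expr.cost] <;> try omega
    simpa [reuseSym, h] using hQ
  · intro h
    simp only [Expr.eval] at h
    apply WP.visit <;> simp only [Expr.eval, Expr.cost] <;> try omega
    simpa [reuseSym, h] using hQ

section

variable {W : ℕ} {Q : List ℕ → Store → ℕ → Prop} {s : Store} {g : ℕ}

/-- The outcome of the pending carry is the invariant, while the pending level drops. Once that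
level is `0`, `carry` returns its arguments, so the invariant then says that the memory holds the
incremented counter. -/
theorem wp_advance (hi : s.var 5 ≤ W) (hW : 1 ≤ W) (hg : g ≤ 900)
    (hQ : ∀ s' g', g' ≤ g + 60 → (∀ x, x ≠ 5 → x ≠ 8 → s'.var x = s.var x) →
      s'.var 5 ≤ s.var 5 - 1 →
      carry (s'.var 5) (s'.arr 0) (s'.arr 1) (s'.var 8) =
        carry (s.var 5) (s.arr 0) (s.arr 1) (s.var 8) →
      Q [] s' g') :
    WP W 1000 advance Q s g := by
  apply WP.ite
  · simp [Expr.cost]; omega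
  · intro h
    simp only [Expr.eval] at h
    obtain ⟨i, hi'⟩ : ∃ i, s.var 5 = i + 1 := ⟨s.var 5 - 1, by omega⟩
    apply WP.ite
    · simp [Expr.cost]; omega
    · intro h'
      simp only [Expr.eval] at h'
      apply WP.seq
      apply WP.put <;> simp only [Expr.eval, Expr.cost] <;> try omega
      apply WP.seq
      apply WP.ite <;> simp only [Expr.eval, Expr.cost, Store.setArr, Function.update_self]
      · omega
      · intro h₁
        apply WP.put <;> simp only [Expr.eval, Expr.cost, Store.setArr] <;> try omega
        apply WP.seq
        apply WP.assign <;> simp only [Expr.eval, Expr.cost, Store.setVar] <;> try omega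
        apply WP.assign <;> simp only [Expr.eval, Expr.cost, Store.setVar] <;> try omega
        apply hQ
        · omega
        · intro x h₅ h₈; simp [h₅, h₈]
        · simp
        · rw [hi'] at h' h₁
          rw [hi', carry, if_pos h']
          simp [carry, recycleSym, h₁]
      · intro h₁
        apply WP.ite <;> simp only [Expr.eval, Expr.cost, Function.update_self]
        · omega
        · intro h₂
          apply WP.put <;> simp only [Expr.eval, Expr.cost, Store.setArr] <;> try omega
          apply WP.seq
          apply WP.assign <;> simp only [Expr.eval, Expr.cost, Store.setVar] <;> try omega
          apply WP.assign <;> simp only [Expr.eval, Expr.cost, Store.setVar] <;> try omega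
          apply hQ
          · omega
          · intro x h₅ h₈; simp [h₅, h₈]
          · simp
          · rw [hi'] at h' h₁ h₂
            rw [hi', carry, if_pos h']
            simp at h₁ h₂
            simp [carry, recycleSym, h₁, h₂]
        · intro h₂
          apply WP.put <;> simp only [Expr.eval, Expr.cost, Store.setArr] <;> try omega
          apply WP.seq
          apply WP.assign <;> simp only [Expr.eval, Expr.cost, Store.setVar] <;> try omega
          apply WP.assign <;> simp only [Expr.eval, Expr.cost, Store.setVar] <;> try omega
          apply hQ
          · omega
          · intro x h₅ h₈; simp [h₅, h₈]
          · simp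
          · rw [hi'] at h' h₁ h₂
            rw [hi', carry, if_pos h']
            simp at h₁ h₂
            simp [carry, recycleSym, h₁, h₂.not_gt]
    · intro h'
      simp only [Expr.eval] at h'
      apply WP.seq
      apply WP.put <;> simp only [Expr.eval, Expr.cost] <;> try omega
      apply WP.seq
      apply WP.put <;> simp only [Expr.eval, Expr.cost, Store.setArr] <;> try omega
      apply WP.assign <;> simp only [Expr.eval, Expr.cost, Store.setVar] <;> try omega
      apply hQ
      · omega
      · intro x h₅ h₈; simp [h₅]
      · simp
      · rw [hi'] at h'
        conv_rhs => rw [hi', carry, if_neg h']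
        simp [hi']
  · intro h
    simp only [Expr.eval] at h
    apply WP.skip
    · simp [Expr.cost]; omega
    · apply hQ
      · simp [Expr.cost]
      · intros; rfl
      · omega
      · rfl

/-- The pending level is at most the number `j` of visits left, and each visit is followed by one
`advance`; the carry is complete at the end. The gap inherits the old one only if nothing is
visited. -/
theorem wp_blockLoop {vis : Cmd} {f : ℕ → ℕ → ℕ → ℕ} (hvis : Visits vis f) {N r j : ℕ}
    (hW : N + 1 ≤ W) (hN : s.var 2 = N) (hr : s.var 7 = r) (hj : s.var 6 + j = N)
    (hi : s.var 5 ≤ j) (hg : g ≤ 800)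
    (hQ : ∀ s' g', (∀ x < 5, s'.var x = s.var x) →
      (s'.arr 0, s'.arr 1, s'.var 8) = carry (s.var 5) (s.arr 0) (s.arr 1) (s.var 8) →
      (j = 0 → g' ≤ g + 5) → (1 ≤ j → g' ≤ 80) → Q ((block f N r).drop (s.var 6)) s' g') :
    WP W 1000 (blockLoop vis) Q s g := by
  induction j generalizing s g Q with
  | zero =>
    apply WP.loop_false
    · simp [Expr.eval]; omega
    · simp [Expr.cost]; omega
    · have h5 : s.var 5 = 0 := by omega
      have := hQ s (g + 5) (fun _ _ => rfl) (by rw [h5]; rfl) (by omega) (by omega)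
      rwa [List.drop_of_length_le (by rw [length_block]; omega)] at this
  | succ j ih =>
    apply WP.loop_true
    · simp [Expr.eval]; omega
    · simp [Expr.cost]; omega
    apply WP.seq
    apply hvis
    · omega
    · simp [Expr.cost]; omega
    apply WP.seq
    apply WP.assign <;> simp only [Expr.eval, Expr.cost] <;> try omega
    apply wp_advance
    · simp [Store.setVar]; omega
    · omega
    · omega
    intro s₁ g₁ hg₁ hx hi₁ hc
    have h2 : s₁.var 2 = N := by rw [hx] <;> simp [Store.setVar, hN]
    have h7 : s₁.var 7 = r := by rw [hx] <;> simp [Store.setVar, hr]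
    have h6 : s₁.var 6 = s.var 6 + 1 := by rw [hx] <;> simp [Store.setVar]
    have h5 : s₁.var 5 ≤ s.var 5 - 1 := by simpa [Store.setVar] using hi₁
    apply ih h2 h7 (by omega) (by omega) (by omega)
    intro s' g' hx' hc' hg' hg''
    rw [h6, hN, hr]
    have := hQ s' g' (fun x hlt => by
      rw [hx' x hlt, hx x (by omega) (by omega)]
      simp [Store.setVar, show x ≠ 6 by omega]) (by rw [hc', hc]; simp [Store.setVar]) (by omega)
      (by omega)
    rw [drop_block f r (show s.var 6 < N by omega)] at this
    simpa using this

/-- The symbol to expand is saved before the carry overwrites it. A carry needs up to `k`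
treatments, but a block that lacks two symbols offers only `k - 1` visits; the extra `advance`
before the loop makes up for this. -/
theorem wp_blockPass {vis : Cmd} {f : ℕ → ℕ → ℕ → ℕ} (hvis : Visits vis f) {k : ℕ}
    (hW : k + 2 ≤ W) (hN : s.var 2 = k + 1) (hd : s.var 6 ≤ 2) (hk : 1 ≤ k)
    (hr : s.arr 1 k ≤ k) (hg : g ≤ 300)
    (hQ : ∀ s' g', (∀ y < 5, s'.var y = s.var y) → s'.var 6 = 0 →
      (s'.arr 0, s'.arr 1, s'.var 8) = carry k (s.arr 0) (s.arr 1) 1 →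
      g' ≤ g + 100 → (2 ≤ k → g' ≤ 100) →
      Q ((block f (k + 1) (s.arr 1 k)).drop (s.var 6)) s' g') :
    WP W 1000 (blockPass vis) Q s g := by
  have hN' : s.var 2 - 1 = k := by omega
  apply WP.seq
  apply WP.assign <;> simp only [Expr.eval, Expr.cost, hN'] <;> try omega
  apply WP.seq
  apply WP.assign <;> simp [Expr.eval, Expr.cost, Store.setVar, hN'] <;> try omega
  apply WP.seq
  apply WP.assign <;> simp [Expr.eval, Expr.cost] <;> try omega
  apply WP.seq
  apply wp_advance
  · simp [Store.setVar]; omega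
  · omega
  · omega
  intro s₁ g₁ hg₁ hx₁ hi₁ hc₁
  have h2 : s₁.var 2 = k + 1 := by rw [hx₁] <;> simp [Store.setVar, hN]
  have h7 : s₁.var 7 = s.arr 1 k := by rw [hx₁] <;> simp [Store.setVar]
  have h6 : s₁.var 6 = s.var 6 := by rw [hx₁] <;> simp [Store.setVar]
  have h5 : s₁.var 5 ≤ k - 1 := by simpa [Store.setVar] using hi₁
  apply WP.seq
  apply wp_blockLoop hvis (j := k + 1 - s.var 6) (by omega) h2 h7 (by omega) (by omega) (by omega)
  intro s₂ g₂ hx₂ hc₂ hg₂ hg₂'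
  -- Nothing is visited only if `k + 1 = 2` and both symbols are skipped.
  have hle : g₂ ≤ 80 ∨ (k = 1 ∧ g₂ ≤ g₁ + 5) := by omega
  apply WP.assign <;> simp [Expr.eval, Expr.cost] <;> try omega
  rw [h6]
  apply hQ
  · intro y hy
    have h₁ := hx₂ y hy
    have h₂ := hx₁ y (by omega) (by omega)
    simp [Store.setVar, show y ≠ 6 by omega, show y ≠ 5 by omega, show y ≠ 7 by omega,
      show y ≠ 8 by omega] at h₁ h₂ ⊢
    rw [h₁, h₂]
  · simp [Store.setVar]
  · simp [Store.setVar] at hc₁ ⊢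
    rw [hc₂, hc₁]
  · omega
  · omega

/-- Induction on the symbols after the current one, with `carry_spec` deciding between another block
and overflow. Both cases share the run of one block. -/
theorem wp_passLoop {vis : Cmd} {f : ℕ → ℕ → ℕ → ℕ} (hvis : Visits vis f) {k x : ℕ} {l : List ℕ}
    (hk : 1 ≤ k) (hW : k + 2 ≤ W) (hN : s.var 2 = k + 1) (hd : s.var 6 ≤ 2) (ho : s.var 8 = 0)
    (hv : Valid k (s.arr 0) (s.arr 1)) (hrem : remaining k (s.arr 0) (s.arr 1) = x :: l)
    (hg : g ≤ 200)
    (hQ : ∀ s' g', (∀ y < 5, s'.var y = s.var y) → AtStart k (s'.arr 0) (s'.arr 1) →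
      g' ≤ 400 →
      Q ((block f (k + 1) x).drop (s.var 6) ++ l.flatMap (block f (k + 1))) s' g') :
    WP W 1000 (passLoop vis) Q s g := by
  induction l generalizing s g x Q with
  | nil => ?_
  | cons y l ih => ?_
  all_goals
    have hx : x = s.arr 1 k := by
      have := hv.remaining_eq hk
      rw [hrem] at this
      exact (List.cons.inj this).1
    have hr : s.arr 1 k ≤ k := by
      rw [(hv k hk le_rfl).2]
      exact recycleSym_le _ _ _
    have hcv := carry_valid hv 1
    obtain ⟨hc₁, hc₂⟩ := carry_spec hk hv
    rw [hrem, List.tail_cons] at hc₁ hc₂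
    apply WP.loop_true
    · simp [Expr.eval, ho]
    · simp [Expr.cost]; omega
    simp only [Expr.cost]
    apply wp_blockPass hvis hW hN hd hk hr (by omega)
    intro s' g' hx' h6 hc hg₁ hg₂
    rw [← hc] at hc₁ hc₂ hcv
    rw [← hx]
  · obtain ⟨h8, hs⟩ := hc₁ rfl
    apply WP.loop_false
    · simp [Expr.eval]; simp at h8; omega
    · simp [Expr.cost]; omega
    simp only [Expr.cost]
    exact hQ s' _ hx' hs (by omega)
  · obtain ⟨h8, hs⟩ := hc₂ (by simp)
    -- For `k = 1` there is a single block, so a block without visits is never followed by another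
    -- and the gaps do not add up.
    have h2k : 2 ≤ k := by
      by_contra hk2
      obtain rfl : k = 1 := by omega
      simp [remaining] at hrem
    have hN' : s'.var 2 = k + 1 := by rw [hx' 2 (by omega), hN]
    apply ih hN' (by omega) h8 hcv hs (by omega)
    intro s'' g'' hx'' hs'' hg''
    rw [h6, List.drop_zero, ← List.flatMap_cons]
    exact hQ s'' g'' (fun z hz => (hx'' z hz).trans (hx' z hz)) hs'' hg''

/-- `AtStart` holds before and after, so passes can be chained without a new initialization. -/
theorem wp_pass {vis : Cmd} {f : ℕ → ℕ → ℕ → ℕ} (hvis : Visits vis f) {k d : ℕ}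
    (hk : 1 ≤ k) (hW : k + 2 ≤ W) (hd : d ≤ 2) (hN : s.var 2 = k + 1)
    (hs : AtStart k (s.arr 0) (s.arr 1)) (hg : g ≤ 100)
    (hQ : ∀ s' g', (∀ y < 5, s'.var y = s.var y) → AtStart k (s'.arr 0) (s'.arr 1) →
      g' ≤ 400 → Q (((recycleSeq k).flatMap (block f (k + 1))).drop d) s' g') :
    WP W 1000 (pass vis d) Q s g := by
  apply WP.seq
  apply WP.assign <;> simp only [Expr.eval, Expr.cost] <;> try omega
  apply WP.seq
  apply WP.assign <;> simp only [Expr.eval, Expr.cost] <;> try omega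
  obtain ⟨x, l, hl⟩ := List.exists_cons_of_ne_nil (recycleSeq_ne_nil hk)
  apply wp_passLoop hvis hk hW (x := x) (l := l)
  · simpa [Store.setVar] using hN
  · simpa [Store.setVar] using hd
  · simp [Store.setVar]
  · exact hs.valid
  · rw [← hl]; exact hs.remaining_eq
  · omega
  intro s' g' hx' hs' hg'
  have := hQ s' g' (fun y hy => by
    rw [hx' y hy]
    simp [Store.setVar, show y ≠ 6 by omega, show y ≠ 8 by omega]) hs' hg'
  rw [hl, List.flatMap_cons, List.drop_append_of_le_length (by rw [length_block]; omega)] at this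
  simpa [Store.setVar] using this

theorem wp_setup {e : Expr} {k K : ℕ} (he : e.eval s = k + 1) (hW : k + 2 ≤ W)
    (hK : g + e.cost + 20 + 20 * k ≤ K) (hD : ∀ i, s.arr 0 i = 0)
    (hQ : ∀ s' g', (∀ y < 2, s'.var y = s.var y) → s'.var 2 = k + 1 →
      AtStart k (s'.arr 0) (s'.arr 1) → Q [] s' g') :
    WP W K (setup e) Q s g := by
  apply WP.seq
  apply WP.assign (by omega) (by omega)
  rw [he]
  apply WP.seq
  apply WP.assign <;> simp only [Expr.eval, Expr.cost] <;> try omega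
  -- Loop invariant: the symbols below level `i` are set and `j` levels remain. The digits are `0`
  -- from the beginning.
  have key : ∀ (j i : ℕ) (s₁ : Store) (g₁ : ℕ), i + j = k + 1 → s₁.var 2 = k + 1 →
      s₁.var 3 = i → 1 ≤ i → (∀ y < 2, s₁.var y = s.var y) → (∀ i, s₁.arr 0 i = 0) →
      (∀ l, 1 ≤ l → l < i → s₁.arr 1 l = l) → g₁ + 10 + 20 * j ≤ K →
      WP W K (.loop (.add (.var 3) (.const 1)) (.var 2)
        (.seq (.put 1 (.var 3) (.var 3)) (.assign 3 (.add (.var 3) (.const 1))))) Q s₁ g₁ := by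
    intro j
    induction j with
    | zero =>
      intro i s₁ g₁ hij h2 h3 hi hx hD hF hg
      apply WP.loop_false
      · simp [Expr.eval]; omega
      · simp [Expr.cost]; omega
      exact hQ _ _ hx h2 fun l h₁ h₂ => ⟨hD l, hF l h₁ (by omega)⟩
    | succ j ih =>
      intro i s₁ g₁ hij h2 h3 hi hx hD hF hg
      apply WP.loop_true
      · simp [Expr.eval]; omega
      · simp [Expr.cost]; omega
      apply WP.seq
      apply WP.put <;> simp only [Expr.eval, Expr.cost, h3] <;> try omega
      apply WP.assign <;> simp [Expr.eval, Expr.cost, Store.setArr, h3] <;> try omega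
      apply ih (i + 1) _ _ (by omega)
      · simpa [Store.setVar] using h2
      · simp [Store.setVar]
      · omega
      · intro y hy
        simpa [Store.setVar, show y ≠ 3 by omega] using hx y hy
      · simpa [Store.setVar] using hD
      · intro l h₁ h₂
        rcases eq_or_ne l i with rfl | hne
        · simp [Store.setVar]
        · simpa [Store.setVar, Function.update_of_ne hne] using hF l h₁ (by omega)
      · omega
  apply key k 1
  · omega
  · simp [Store.setVar]
  · simp [Store.setVar]
  · omega
  · intro y hy
    simp [Store.setVar, show y ≠ 3 by omega, show y ≠ 2 by omega]
  · simpa [Store.setVar] using hD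
  · intro l h₁ h₂; omega
  · omega

theorem wp_rewindMain {vis : Cmd} {f : ℕ → ℕ → ℕ → ℕ} (hvis : Visits vis f) {k m : ℕ}
    {T : List ℕ} (hT : T = ((recycleSeq k).flatMap (block f (k + 1))).drop 2)
    (hk : 1 ≤ k) (hW : k + 2 ≤ W) (hm : 2 ≤ m) (hmW : m ≤ W) (h0 : s.var 0 = k + 2)
    (h1 : s.var 1 = m) (hN : s.var 2 = k + 1) (hs : AtStart k (s.arr 0) (s.arr 1)) (hg : g ≤ 100)
    (hQ : ∀ s' g', Q (T ++ [k + 1, k + 2] ++ (List.replicate (m - 2) (T ++ [k + 2])).flatten ++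
      T ++ [k + 1, k + 2] ++ List.replicate (m - 2) (k + 2)) s' g') :
    WP W 1000 (rewindMain vis) Q s g := by
  -- Both counting loops run from `2` up to `m`, hence `m - 2` times.
  have tail : ∀ (j : ℕ) (Q : List ℕ → Store → ℕ → Prop) (s : Store) (g : ℕ), s.var 0 = k + 2 →
      s.var 1 = m → s.var 3 + j = m → g ≤ 100 → (∀ s' g', Q (List.replicate j (k + 2)) s' g') →
      WP W 1000 (.loop (.add (.var 3) (.const 1)) (.var 1)
        (.seq (.visit (.var 0)) (.assign 3 (.add (.var 3) (.const 1))))) Q s g := by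
    intro j
    induction j with
    | zero =>
      intro Q s g h0 h1 h3 hg hQ
      apply WP.loop_false
      · simp [Expr.eval]; omega
      · simp [Expr.cost]; omega
      · exact hQ _ _
    | succ j ih =>
      intro Q s g h0 h1 h3 hg hQ
      apply WP.loop_true
      · simp [Expr.eval]; omega
      · simp [Expr.cost]; omega
      apply WP.seq
      apply WP.visit <;> simp only [Expr.eval, Expr.cost] <;> try omega
      apply WP.assign <;> simp only [Expr.eval, Expr.cost] <;> try omega
      apply ih
      · simpa [Store.setVar] using h0
      · simpa [Store.setVar] using h1
      · simp [Store.setVar]; omega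
      · omega
      · intro s' g'
        simpa [h0, List.replicate_succ] using hQ s' g'
  have middle : ∀ (j : ℕ) (Q : List ℕ → Store → ℕ → Prop) (s : Store) (g : ℕ), s.var 0 = k + 2 →
      s.var 1 = m → s.var 2 = k + 1 → s.var 3 + j = m → AtStart k (s.arr 0) (s.arr 1) →
      g ≤ 50 →
      (∀ s' g', s'.var 0 = k + 2 → s'.var 1 = m → s'.var 2 = k + 1 →
        AtStart k (s'.arr 0) (s'.arr 1) → g' ≤ 100 →
        Q (List.replicate j (T ++ [k + 2])).flatten s' g') →
      WP W 1000 (.loop (.add (.var 3) (.const 1)) (.var 1)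
        (.seq (pass vis 2)
        (.seq (.visit (.var 0)) (.assign 3 (.add (.var 3) (.const 1)))))) Q s g := by
    intro j
    induction j with
    | zero =>
      intro Q s g h0 h1 h2 h3 hs hg hQ
      apply WP.loop_false
      · simp [Expr.eval]; omega
      · simp [Expr.cost]; omega
      · exact hQ _ _ h0 h1 h2 hs (by simp only [Expr.cost]; omega)
    | succ j ih =>
      intro Q s g h0 h1 h2 h3 hs hg hQ
      apply WP.loop_true
      · simp [Expr.eval]; omega
      · simp [Expr.cost]; omega
      apply WP.seq
      apply wp_pass hvis hk hW le_rfl h2 hs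
      · simp only [Expr.cost]; omega
      intro s' g' hx' hs' hg'
      have e0 := hx' 0 (by omega)
      have e1 := hx' 1 (by omega)
      have e2 := hx' 2 (by omega)
      have e3 := hx' 3 (by omega)
      rw [← hT]
      apply WP.seq
      apply WP.visit <;> simp only [Expr.eval, Expr.cost] <;> try omega
      apply WP.assign <;> simp only [Expr.eval, Expr.cost] <;> try omega
      apply ih
      · simp [Store.setVar]; omega
      · simp [Store.setVar]; omega
      · simp [Store.setVar]; omega
      · simp [Store.setVar]; omega
      · exact hs'
      · omega
      · intro s'' g'' k0 k1 k2 ks kg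
        have := hQ s'' g'' k0 k1 k2 ks kg
        simpa [e0, h0, List.replicate_succ] using this
  apply WP.seq
  apply wp_pass hvis hk hW le_rfl hN hs hg
  intro s₁ g₁ hx₁ hs₁ hg₁
  have a0 := hx₁ 0 (by omega)
  have a1 := hx₁ 1 (by omega)
  have a2 := hx₁ 2 (by omega)
  rw [← hT]
  apply WP.seq
  apply WP.visit <;> simp only [Expr.eval, Expr.cost] <;> try omega
  apply WP.seq
  apply WP.visit <;> simp only [Expr.eval, Expr.cost] <;> try omega
  apply WP.seq
  apply WP.assign <;> simp only [Expr.eval, Expr.cost] <;> try omega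
  apply WP.seq
  apply middle (m - 2)
  · simp [Store.setVar]; omega
  · simp [Store.setVar]; omega
  · simp [Store.setVar]; omega
  · simp [Store.setVar]; omega
  · exact hs₁
  · omega
  intro s₂ g₂ b0 b1 b2 hs₂ hg₂
  apply WP.seq
  apply wp_pass hvis hk hW le_rfl b2 hs₂ hg₂
  intro s₃ g₃ hx₃ hs₃ hg₃
  have c0 := hx₃ 0 (by omega)
  have c1 := hx₃ 1 (by omega)
  rw [← hT]
  apply WP.seq
  apply WP.visit <;> simp only [Expr.eval, Expr.cost] <;> try omega
  apply WP.seq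
  apply WP.visit <;> simp only [Expr.eval, Expr.cost] <;> try omega
  apply WP.seq
  apply WP.assign <;> simp only [Expr.eval, Expr.cost] <;> try omega
  apply tail (m - 2)
  · simp [Store.setVar]; omega
  · simp [Store.setVar]; omega
  · simp [Store.setVar]; omega
  · omega
  intro s' g'
  simpa [a0, c0, b0, h0] using hQ s' g'

end

/-! ### The three families -/

theorem two_le_length_flatMap_block (f : ℕ → ℕ → ℕ → ℕ) {k : ℕ} (hk : 1 ≤ k) :
    2 ≤ ((recycleSeq k).flatMap (block f (k + 1))).length := by
  obtain ⟨x, l, hl⟩ := List.exists_cons_of_ne_nil (recycleSeq_ne_nil hk)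
  rw [hl, List.flatMap_cons, List.length_append, length_block]
  omega

theorem looplesslyGenerates_reuse {n : ℕ} (hn : 2 ≤ n) :
    LooplesslyGenerates (.seq (setup (.var 0)) (pass visitReuse 0)) 2000 n [n]
      (reuse n (recycleSeq (n - 1))) := by
  obtain ⟨k, rfl⟩ : ∃ k, n = k + 1 := ⟨n - 1, by omega⟩
  -- `K` allows 20 units for each of the `k` levels set up. The factor 2000 is generous: it only has
  -- to exceed `P` and give `K + P ≤ 2000 * (k + 1)`.
  apply LooplesslyGenerates.of_wp (P := 1000) (K := 30 + 20 * k)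
  · apply wp_setup (k := k)
    · simp [Expr.eval, Store.input]
    · omega
    · simp only [Expr.cost]; omega
    · intro i; rfl
    intro s g _ h2 hs
    refine ⟨rfl, ?_⟩
    apply wp_pass visits_visitReuse (by omega) (by omega) (by omega) h2 hs (by omega)
    intro s' g' _ _ _
    rw [List.drop_zero, reuse_eq _ (by omega)]
    rfl
  · omega
  · omega

theorem looplesslyGenerates_rewind {vis : Cmd} {f : ℕ → ℕ → ℕ → ℕ} (hvis : Visits vis f)
    {k m : ℕ} (hk : 1 ≤ k) (hm : 2 ≤ m) (hmk : m ≤ k + 2) :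
    LooplesslyGenerates (.seq (setup (.sub (.var 0) (.const 1))) (rewindMain vis)) 2000 (k + 2)
      [k + 2, m]
      (rewind (k + 2) m (shiftTwo ((recycleSeq k).flatMap (block f (k + 1))))) := by
  apply LooplesslyGenerates.of_wp (P := 1000) (K := 30 + 20 * k)
  · apply wp_setup (k := k)
    · simp [Expr.eval, Store.input]
    · omega
    · simp only [Expr.cost]; omega
    · intro i; rfl
    intro s g hx h2 hs
    refine ⟨rfl, ?_⟩
    apply wp_rewindMain hvis rfl hk (by omega) hm (by omega) _ _ h2 hs (by omega)
    · intro s' g'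
      rw [rewind_shiftTwo _ _ (two_le_length_flatMap_block f hk)]
      rfl
    · rw [hx 0 (by omega)]; rfl
    · rw [hx 1 (by omega)]; rfl
  · omega
  · omega

end Rotator

theorem mainTheorem8 :
    (∃ (p : Rotator.Cmd) (C : ℕ), ∀ n : ℕ, 2 ≤ n →
      Rotator.LooplesslyGenerates p C n [n]
        (Rotator.reuse n (Rotator.recycleSeq (n - 1)))) ∧
    (∃ (p : Rotator.Cmd) (C : ℕ), ∀ n m : ℕ, 3 ≤ n → 2 ≤ m → m ≤ n →
      Rotator.LooplesslyGenerates p C n [n, m]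
        (Rotator.rewind n m (Rotator.shiftTwo (Rotator.recycleSeq (n - 1))))) ∧
    (∃ (p : Rotator.Cmd) (C : ℕ), ∀ n m : ℕ, 3 ≤ n → 2 ≤ m → m ≤ n →
      Rotator.LooplesslyGenerates p C n [n, m]
        (Rotator.rewind n m
          (Rotator.shiftTwo (Rotator.reuse (n - 1) (Rotator.recycleSeq (n - 2)))))) := by
  refine ⟨⟨_, _, fun n hn => Rotator.looplesslyGenerates_reuse hn⟩,
    ⟨.seq (Rotator.setup (.sub (.var 0) (.const 1))) (Rotator.rewindMain Rotator.visitRecycle),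
      2000, fun n m hn hm hmn => ?_⟩,
    ⟨.seq (Rotator.setup (.sub (.var 0) (.const 1))) (Rotator.rewindMain Rotator.visitReuse),
      2000, fun n m hn hm hmn => ?_⟩⟩
  all_goals obtain ⟨k, rfl⟩ : ∃ k, n = k + 2 := ⟨n - 2, by omega⟩
  · have := Rotator.looplesslyGenerates_rewind Rotator.visits_visitRecycle (k := k) (m := m)
      (by omega) hm hmn
    rwa [← Rotator.recycleSeq_succ (by omega)] at this
  · have := Rotator.looplesslyGenerates_rewind Rotator.visits_visitReuse (k := k) (m := m)
      (by omega) hm hmn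
    rwa [← Rotator.reuse_eq _ (by omega)] at this
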